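/- Let $p\in[0,1]$, and let $D$ be the set of those triples in $\{0,1,2\}^3$ at most one of whose coordinates equals $1$ (so $\# D=20$). For $i\in D$ put $f_i(x)=\frac13x+\frac13 i$ on $\mathbb{R}^3$; these are the similarities that define the Menger sponge. For every finite word $\mathbf i$ over $D$ (including the empty word) and every $k\in D$ toss a coin that lands on head with probability $p$, all tosses being independent. Let $X_0$ consist of the empty word, and let $X_{n+1}$ be the set of words $\mathbf i k$ with $\mathbf i\in X_n$, $k\in D$ such that the toss belonging to $(\mathbf i,k)$ is head. The random Menger sponge is $$\mathcal M_p=\bigcap_{n\ge 1}\ \bigcup_{i_1\cdots i_n\in X_n} f_{i_1}\circ\cdots\circ f_{i_n}\big([0,1]^3\big).$$ Non-extinction is the event that there is an infinite sequence over $D$ whose prefix of length $n$ lies in $X_n$ for every $n$. Let $\mathrm{proj}_{(1,1,1)}(x,y,z)=x+y+z$; intervals are understood to be non-degenerate. (1) If $p>\frac16$, then non-extinction has positive probability and, conditioned on non-extinction, $\mathrm{proj}_{(1,1,1)}(\mathcal M_p)$ almost surely contains an interval. (2) If $p<\frac16$, then almost surely $\mathrm{proj}_{(1,1,1)}(\mathcal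 M_p)$ does not contain an interval. -/

import Mathlib

/-! Coin tossing self-similar sets and the random Menger sponge. -/

namespace RandomMenger

noncomputable section

/-- A family of independent coin tosses with head probability `p`: for every finite word `i` over
the alphabet `ι` (a node of the tree) and every letter `k` there is one toss, which is head when
`coin (i, k) ω = true`. -/
structure IsCoinTossing {ι Ω : Type*} [MeasurableSpace Ω] (P : MeasureTheory.Measure Ω) (p : ℝ)
    (coin : List ι × ι → Ω → Bool) : Prop where
  measurable : ∀ e, Measurable (coin e)
  indep : ProbabilityTheory.iIndepFun coin P
  prob_head : ∀ e, P {ω | coin e ω = true} = ENNReal.ofReal p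

/-- The set `X_n` of retained words of length `n`. The empty word is retained, and a word
`i k` is retained when `i` is retained and the toss of the letter `k` at `i` is head. -/
def retained {ι : Type*} (c : List ι × ι → Bool) : ℕ → Set (List ι)
  | 0 => {[]}
  | n + 1 => {w | ∃ i ∈ retained c n, ∃ k : ι, c (i, k) = true ∧ w = i ++ [k]}

/-- The word formed by the first `n` letters of an infinite path. -/
def pathPrefix {ι : Type*} (x : ℕ → ι) (n : ℕ) : List ι :=
  List.ofFn fun j : Fin n => x j

/-- The infinite paths all of whose finite prefixes are retained. -/
def retainedPaths {ι : Type*} (c : List ι × ι → Bool) : Set (ℕ → ι) :=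
  {x | ∀ n, pathPrefix x n ∈ retained c n}

/-- Non-extinction: at least one infinite path is retained. -/
def NonExtinct {ι : Type*} (c : List ι × ι → Bool) : Prop :=
  (retainedPaths c).Nonempty

/-- The composition `f_{i₁} ∘ ⋯ ∘ f_{iₙ}` along a word `i₁ ⋯ iₙ`. -/
def wordMap {ι E : Type*} (f : ι → E → E) : List ι → E → E
  | [] => id
  | k :: w => f k ∘ wordMap f w

/-- The coin tossing self-similar set of the maps `f`, where `B` is a compact set that every
`f i` maps into itself: the intersection over `n ≥ 1` of the unions of the sets `f_i(B)` over the
retained words `i` of length `n`. -/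
def coinTossingSet {ι E : Type*} (f : ι → E → E) (B : Set E) (c : List ι × ι → Bool) : Set E :=
  ⋂ (n : ℕ) (_ : 1 ≤ n), ⋃ i ∈ retained c n, wordMap f i '' B

/-- The positions, in units of `1/3`, of the lower corners of the `20` subcubes of side `1/3` kept
in the Menger sponge: the six face centres and the centre of the cube are removed. -/
def mengerDigits : Finset (Fin 3 → Fin 3) :=
  Finset.univ \ {![1, 1, 0], ![1, 0, 1], ![0, 1, 1], ![1, 1, 2], ![1, 2, 1], ![2, 1, 1],
    ![1, 1, 1]}

theorem card_mengerDigits : mengerDigits.card = 20 := by decide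

/-- The maps `x ↦ x / 3 + t` of the Menger sponge, indexed by the translation `t = i / 3`. -/
def mengerMap (i : mengerDigits) (x : Fin 3 → ℝ) : Fin 3 → ℝ :=
  fun j => (1 / 3) * x j + ((i.1 j : ℕ) : ℝ) / 3

/-- The unit cube `[0, 1]³`. -/
def unitCube : Set (Fin 3 → ℝ) := {x | ∀ j, 0 ≤ x j ∧ x j ≤ 1}

theorem isCompact_unitCube : IsCompact unitCube := by
  have h : unitCube = Set.Icc (0 : Fin 3 → ℝ) 1 := by
    ext x
    simp [unitCube, Set.mem_Icc, Pi.le_def, forall_and]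
  rw [h]
  exact isCompact_Icc

theorem mengerMap_image_subset (i : mengerDigits) : mengerMap i '' unitCube ⊆ unitCube := by
  rintro _ ⟨x, hx, rfl⟩ j
  have h2 : ((i.1 j : ℕ) : ℝ) ≤ 2 := by
    have := (i.1 j).isLt
    exact_mod_cast (by omega : (i.1 j : ℕ) ≤ 2)
  have h0 : (0 : ℝ) ≤ ((i.1 j : ℕ) : ℝ) := Nat.cast_nonneg _
  obtain ⟨h3, h4⟩ := hx j
  simp only [mengerMap]
  constructor <;> linarith

/-- The random Menger sponge, as a function of the outcomes of the tosses. -/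
def mengerSponge (c : List mengerDigits × mengerDigits → Bool) : Set (Fin 3 → ℝ) :=
  coinTossingSet mengerMap unitCube c

/-- The projection `(x, y, z) ↦ a x + b y + c z`. -/
def proj (a b c : ℝ) (x : Fin 3 → ℝ) : ℝ := a * x 0 + b * x 1 + c * x 2

/-- The set contains a non-degenerate interval. -/
def ContainsInterval (s : Set ℝ) : Prop := ∃ a b : ℝ, a < b ∧ Set.Icc a b ⊆ s

end

end RandomMenger

/-! A cube of level `n` coded by `w` projects onto three consecutive cells of length `3⁻ⁿ`,
beginning at `address w`. Passing to a child replaces the address `a` by `3 * a + s`, where the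
digit sums `s = 0, …, 6` occur `1, 3, 3, 6, 3, 3, 1` times. A cell is covered by the cubes of three
consecutive addresses, and a new address receives contributions from the digit sums of one residue
class mod 3, with totals `8, 6, 6`. The smallest total, 6, gives the threshold `p = 1/6`.

Below the threshold, a first moment estimate at a triadic point suffices. The number of cubes of the
full sponge over this point grows essentially like `6 ^ k`, so the expected number of retained ones
tends to 0. Almost surely all triadic points are missed, and they are dense (`sum_offsetWeight_le`,
`IsCoinTossing.ae_triadic_notMem`).

Above the threshold, suppose that every address needed over a fixed triadic cell occurs at least `M
* γ ^ k` times. Every needed address of the next level then has at least `6 * M * γ ^ k` candidate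
tosses, of mean number of heads above `M * γ ^ (k + 1)` for suitable `γ > 1`. The Chernoff bound
makes failure doubly exponentially unlikely in `k`, against only exponentially many cells. Starting
from a full tree of large depth, which has positive probability, the cell stays covered forever with
positive probability (`IsCoinTossing.prob_coverEvent_pos`).

Finally, `coverEvent` passes from a child of the root to the root. Comparing its probability with
the fixed point equation for survival shows that it has either probability zero or that of survival
(`IsCoinTossing.prob_survives_diff_eq_zero`). -/

namespace RandomMenger

open MeasureTheory ProbabilityTheory

/-! ### Retained words, survival and König's lemma -/

section Tree

variable {ι : Type*}

theorem length_of_mem_retained {c : List ι × ι → Bool} {n : ℕ} {w : List ι}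
    (h : w ∈ retained c n) : w.length = n := by
  induction n generalizing w with
  | zero => simp_all [retained]
  | succ n ih =>
    obtain ⟨i, hi, k, -, rfl⟩ := h
    simp [ih hi]

theorem append_mem_retained {c : List ι × ι → Bool} {n : ℕ} {w : List ι} {k : ι} :
    w ++ [k] ∈ retained c (n + 1) ↔ w ∈ retained c n ∧ c (w, k) = true := by
  constructor
  · rintro ⟨i, hi, k', hk, h⟩
    obtain ⟨rfl, h'⟩ := List.append_inj' h rfl
    obtain rfl : k = k' := by simpa using h'
    exact ⟨hi, hk⟩
  · rintro ⟨hi, hk⟩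
    exact ⟨w, hi, k, hk, rfl⟩

theorem retained_congr {c c' : List ι × ι → Bool} {n : ℕ}
    (h : ∀ e, e.1.length < n → c e = c' e) : retained c n = retained c' n := by
  induction n with
  | zero => rfl
  | succ n ih =>
    have ih := ih fun e he => h e (by omega)
    ext w
    simp only [retained, ← ih, Set.mem_ofPred_eq]
    refine exists_congr fun i => and_congr_right fun hi => exists_congr fun k => ?_
    rw [h (i, k) (by simp [length_of_mem_retained hi])]

/-- The tosses seen from the child `k` of the root. -/
def subtree (c : List ι × ι → Bool) (k : ι) : List ι × ι → Bool :=
  fun e => c (k :: e.1, e.2)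

/-- Generations grow at the end of a word, whereas the branching recursion splits at the root; this
lemma converts between the two. -/
theorem cons_mem_retained {c : List ι × ι → Bool} {n : ℕ} {k : ι} {w : List ι} :
    k :: w ∈ retained c (n + 1) ↔ c ([], k) = true ∧ w ∈ retained (subtree c k) n := by
  induction n generalizing w with
  | zero =>
    have := append_mem_retained (c := c) (n := 0) (w := []) (k := k)
    constructor
    · intro h
      obtain rfl : w = [] := by simpa using length_of_mem_retained h
      exact ⟨(this.1 h).2, rfl⟩
    · rintro ⟨h, rfl⟩
      exact this.2 ⟨rfl, h⟩
  | succ n ih =>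
    rcases List.eq_nil_or_concat w with rfl | ⟨i, l, rfl⟩
    · constructor
      · intro h
        simpa using length_of_mem_retained h
      · rintro ⟨-, h⟩
        simpa using length_of_mem_retained h
    · rw [List.concat_eq_append, ← List.cons_append, append_mem_retained, ih, append_mem_retained,
        and_assoc]
      rfl

theorem exists_cons_of_mem_retained_succ {c : List ι × ι → Bool} {n : ℕ} {w : List ι}
    (h : w ∈ retained c (n + 1)) :
    ∃ k v, w = k :: v ∧ c ([], k) = true ∧ v ∈ retained (subtree c k) n := by
  cases w with
  | nil => simpa using length_of_mem_retained h
  | cons k v => exact ⟨k, v, rfl, cons_mem_retained.1 h⟩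

theorem retained_nonempty_of_succ {c : List ι × ι → Bool} {n : ℕ}
    (h : (retained c (n + 1)).Nonempty) : (retained c n).Nonempty := by
  obtain ⟨w, i, hi, -⟩ := h
  exact ⟨i, hi⟩

theorem retained_nonempty_of_le {c : List ι × ι → Bool} {m n : ℕ} (hmn : m ≤ n)
    (h : (retained c n).Nonempty) : (retained c m).Nonempty := by
  induction n, hmn using Nat.le_induction with
  | base => exact h
  | succ n _ ih => exact ih (retained_nonempty_of_succ h)

/-- Every generation is nonempty. -/
def Survives (c : List ι × ι → Bool) : Prop := ∀ n, (retained c n).Nonempty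

theorem survives_iff_exists_subtree [Finite ι] {c : List ι × ι → Bool} :
    Survives c ↔ ∃ k, c ([], k) = true ∧ Survives (subtree c k) := by
  constructor
  · intro h
    by_contra! hk
    have : ∀ k, ∃ n, c ([], k) = true → ¬ (retained (subtree c k) n).Nonempty := by
      intro k
      by_cases hc : c ([], k) = true
      · obtain ⟨n, hn⟩ := not_forall.1 (hk k hc)
        exact ⟨n, fun _ => hn⟩
      · exact ⟨0, fun h => absurd h hc⟩
    choose N hN using this
    -- With finitely many children, one level `M` is past the extinction time of every retained
    -- child, so level `M + 1` of the whole tree is empty.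
    obtain ⟨M, hM⟩ := (Set.finite_range N).bddAbove
    obtain ⟨w, hw⟩ := h (M + 1)
    obtain ⟨k, v, rfl, hc, hv⟩ := exists_cons_of_mem_retained_succ hw
    exact hN k hc (retained_nonempty_of_le (hM ⟨k, rfl⟩) ⟨v, hv⟩)
  · rintro ⟨k, hc, h⟩ n
    obtain ⟨v, hv⟩ := h n
    exact retained_nonempty_of_succ ⟨k :: v, cons_mem_retained.2 ⟨hc, hv⟩⟩

theorem pathPrefix_succ (x : ℕ → ι) (n : ℕ) :
    pathPrefix x (n + 1) = x 0 :: pathPrefix (fun j => x (j + 1)) n := by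
  simp [pathPrefix, List.ofFn_succ]

theorem nonExtinct_iff_survives [Finite ι] {c : List ι × ι → Bool} :
    NonExtinct c ↔ Survives c := by
  constructor
  · rintro ⟨x, hx⟩ n
    exact ⟨_, hx n⟩
  · intro h
    have step : ∀ d : {d : List ι × ι → Bool // Survives d},
        ∃ k, d.1 ([], k) = true ∧ Survives (subtree d.1 k) :=
      fun d => survives_iff_exists_subtree.1 d.2
    choose next hnext hsub using step
    -- König's lemma: always move to a child whose subtree survives; the chosen letters form the
    -- path.
    let state : {d : List ι × ι → Bool // Survives d} → ℕ → {d : List ι × ι → Bool // Survives d} :=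
      fun d n => (fun d => ⟨subtree d.1 (next d), hsub d⟩)^[n] d
    have key : ∀ n d, pathPrefix (fun j => next (state d j)) n ∈ retained d.1 n := by
      intro n
      induction n with
      | zero => intro d; simp [pathPrefix, retained]
      | succ n ih =>
        intro d
        rw [pathPrefix_succ, cons_mem_retained]
        exact ⟨hnext d, ih ⟨_, hsub d⟩⟩
    exact ⟨_, fun n => key n ⟨c, h⟩⟩

theorem finite_retained [Finite ι] (c : List ι × ι → Bool) (n : ℕ) : (retained c n).Finite :=
  (List.finite_length_eq ι n).subset fun _ h => length_of_mem_retained h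

/-- The retained words of length `n`, as a finite set. -/
noncomputable def retainedFinset [Finite ι] (c : List ι × ι → Bool) (n : ℕ) : Finset (List ι) :=
  (finite_retained c n).toFinset

@[simp]
theorem mem_retainedFinset [Finite ι] {c : List ι × ι → Bool} {n : ℕ} {w : List ι} :
    w ∈ retainedFinset c n ↔ w ∈ retained c n := by
  simp [retainedFinset]

theorem retainedFinset_congr [Finite ι] {c c' : List ι × ι → Bool} {n : ℕ}
    (h : ∀ e, e.1.length < n → c e = c' e) : retainedFinset c n = retainedFinset c' n := by
  ext w
  simp [retained_congr h]

theorem measurableSet_mem_retained [Countable ι] (w : List ι) (n : ℕ) :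
    MeasurableSet {c : List ι × ι → Bool | w ∈ retained c n} := by
  induction n generalizing w with
  | zero => simp [retained]
  | succ n ih =>
    have : {c : List ι × ι → Bool | w ∈ retained c (n + 1)} =
        ⋃ (i : List ι) (k : ι), {c | i ∈ retained c n} ∩
          ({c | c (i, k) = true} ∩ {_c | w = i ++ [k]}) := by
      ext c; simp [retained]
    rw [this]
    refine .iUnion fun i => .iUnion fun k => (ih i).inter (.inter ?_ (.const _))
    exact measurableSet_eq_fun (measurable_pi_apply (i, k)) measurable_const

theorem measurableSet_retainedFinset_eq [Finite ι] (n : ℕ) (S : Finset (List ι)) :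
    MeasurableSet {c : List ι × ι → Bool | retainedFinset c n = S} := by
  have : {c : List ι × ι → Bool | retainedFinset c n = S} =
      ⋂ w, {c | w ∈ retained c n ↔ w ∈ S} := by
    ext c; simp [Finset.ext_iff]
  rw [this]
  exact .iInter fun w => (measurableSet_mem_retained w n).iff (.const _)

theorem measurableSet_survives [Finite ι] :
    MeasurableSet {c : List ι × ι → Bool | Survives c} := by
  have : {c : List ι × ι → Bool | Survives c} = ⋂ n, ⋃ w, {c | w ∈ retained c n} := by
    ext c; simp [Survives, Set.Nonempty]
  rw [this]
  exact .iInter fun n => .iUnion fun w => measurableSet_mem_retained w n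

theorem measurable_subtree (k : ι) : Measurable fun c : List ι × ι → Bool => subtree c k :=
  measurable_pi_lambda _ fun _ => measurable_pi_apply _

end Tree

/-! ### Independence of disjoint tosses and self-similarity of the law -/

section Independence

variable {ι Ω : Type*} [MeasurableSpace Ω] {P : Measure Ω} {p : ℝ} {coin : List ι × ι → Ω → Bool}

theorem IsCoinTossing.measurable_pi (h : IsCoinTossing P p coin) :
    Measurable fun ω e => coin e ω :=
  measurable_pi_lambda _ h.measurable

/-- Events that depend on disjoint sets of tosses are independent. -/
theorem IsCoinTossing.measure_inter_of_dependsOn (h : IsCoinTossing P p coin)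
    {S T : Set (List ι × ι)} (hST : Disjoint S T) {A B : Set (List ι × ι → Bool)}
    (hA : MeasurableSet A) (hB : MeasurableSet B)
    (hAS : DependsOn (· ∈ A) S) (hBT : DependsOn (· ∈ B) T) :
    P {ω | (fun e => coin e ω) ∈ A ∧ (fun e => coin e ω) ∈ B} =
      P {ω | (fun e => coin e ω) ∈ A} * P {ω | (fun e => coin e ω) ∈ B} := by
  classical
  have hind := indep_iSup_of_disjoint (fun e => (h.measurable e).comap_le) h.indep.iIndep hST
  have key : ∀ {S : Set (List ι × ι)} {A : Set (List ι × ι → Bool)}, MeasurableSet A →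
      DependsOn (· ∈ A) S →
      MeasurableSet[⨆ e ∈ S, MeasurableSpace.comap (coin e) inferInstance]
        {ω | (fun e => coin e ω) ∈ A} := by
    intro S A hA hAS
    -- Tosses outside `S` are overwritten by the default `false`; this does not change membership in
    -- `A`, which depends on `S` only.
    have hm : Measurable[⨆ e ∈ S, MeasurableSpace.comap (coin e) inferInstance]
        fun ω e => if e ∈ S then coin e ω else false := by
      refine @measurable_pi_lambda _ _ _ (_) _ _ fun e => ?_
      by_cases he : e ∈ S
      · simp only [he, if_true]
        exact Measurable.mono (comap_measurable (coin e))
          (le_iSup₂_of_le e he le_rfl) le_rfl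
      · simp only [he, if_false]
        exact @measurable_const _ _ _ (_) _
    have := hm hA
    convert this using 1
    ext ω
    exact (hAS fun _ he => by simp [he]).to_iff
  exact (Indep_iff _ _ _).1 hind _ _ (key hA hAS) (key hB hBT)

theorem IsCoinTossing.precomp (h : IsCoinTossing P p coin) {g : List ι × ι → List ι × ι}
    (hg : g.Injective) : IsCoinTossing P p fun e => coin (g e) where
  measurable _ := h.measurable _
  indep := h.indep.precomp hg
  prob_head _ := h.prob_head _

theorem IsCoinTossing.subtree (h : IsCoinTossing P p coin) (k : ι) :
    IsCoinTossing P p fun e => coin (k :: e.1, e.2) := by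
  refine h.precomp (g := fun e => (k :: e.1, e.2)) ?_
  rintro ⟨i, a⟩ ⟨j, b⟩ hij
  simpa using hij

/-- The law of the tosses does not depend on the probability space. -/
theorem IsCoinTossing.measure_eq {Ω' : Type*} [MeasurableSpace Ω'] {P' : Measure Ω'}
    {coin' : List ι × ι → Ω' → Bool} (h : IsCoinTossing P p coin) (h' : IsCoinTossing P' p coin')
    {A : Set (List ι × ι → Bool)} (hA : MeasurableSet A) :
    P {ω | (fun e => coin e ω) ∈ A} = P' {ω | (fun e => coin' e ω) ∈ A} := by
  have := h.indep.isProbabilityMeasure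
  have := h'.indep.isProbabilityMeasure
  have hmap : ∀ e, P.map (coin e) = P'.map (coin' e) := by
    intro e
    have := Measure.isProbabilityMeasure_map (h.measurable e).aemeasurable (μ := P)
    have := Measure.isProbabilityMeasure_map (h'.measurable e).aemeasurable (μ := P')
    have ht : P.map (coin e) {true} = P'.map (coin' e) {true} := by
      rw [Measure.map_apply (h.measurable e) (measurableSet_singleton _),
        Measure.map_apply (h'.measurable e) (measurableSet_singleton _)]
      exact (h.prob_head e).trans (h'.prob_head e).symm
    refine Measure.ext_of_singleton fun b => ?_
    cases b with
    | true => exact ht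
    | false =>
      have : ({false} : Set Bool) = {true}ᶜ := by ext b; cases b <;> simp
      rw [this, prob_compl_eq_one_sub (measurableSet_singleton _),
        prob_compl_eq_one_sub (measurableSet_singleton _), ht]
  have hpi : P.map (fun ω e => coin e ω) = P'.map (fun ω e => coin' e ω) := by
    rw [h.indep.map_fun_eq_infinitePi_map h.measurable,
      h'.indep.map_fun_eq_infinitePi_map h'.measurable]
    simp only [hmap]
  have := congrArg (fun μ => μ A) hpi
  simp only [Measure.map_apply h.measurable_pi hA, Measure.map_apply h'.measurable_pi hA] at this
  exact this

theorem IsCoinTossing.prob_subtree (h : IsCoinTossing P p coin) (k : ι)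
    {A : Set (List ι × ι → Bool)} (hA : MeasurableSet A) :
    P {ω | RandomMenger.subtree (fun e => coin e ω) k ∈ A} = P {ω | (fun e => coin e ω) ∈ A} :=
  (h.subtree k).measure_eq h hA

/-- The child `k` of the root is retained and the tosses seen from it lie in `A`. -/
def childEvent (A : Set (List ι × ι → Bool)) (k : ι) : Set (List ι × ι → Bool) :=
  {c | c ([], k) = true ∧ RandomMenger.subtree c k ∈ A}

theorem measurableSet_toss (e : List ι × ι) :
    MeasurableSet {c : List ι × ι → Bool | c e = true} :=
  measurableSet_eq_fun (measurable_pi_apply e) measurable_const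

theorem measurableSet_childEvent {A : Set (List ι × ι → Bool)} (hA : MeasurableSet A) (k : ι) :
    MeasurableSet (childEvent A k) :=
  (measurableSet_toss _).inter (measurable_subtree k hA)

theorem IsCoinTossing.prob_childEvent (h : IsCoinTossing P p coin) (k : ι)
    {A : Set (List ι × ι → Bool)} (hA : MeasurableSet A) :
    P {ω | (fun e => coin e ω) ∈ childEvent A k} =
      ENNReal.ofReal p * P {ω | (fun e => coin e ω) ∈ A} := by
  rw [← h.prob_subtree k hA, ← h.prob_head ([], k)]
  refine h.measure_inter_of_dependsOn (S := {([], k)}) (T := {e | e.1 ≠ []}) (by simp)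
    (measurableSet_toss ([], k)) (measurable_subtree k hA) ?_ ?_
  · intro c c' hcc
    simp [hcc ([], k) rfl]
  · intro c c' hcc
    have : RandomMenger.subtree c k = RandomMenger.subtree c' k :=
      funext fun e => hcc _ (by simp)
    simp [this]

/-- Indexing tosses by the first letter of the word they create treats the root toss of `k` and the
tosses below `k` alike, and gives disjoint sets for different `k`. -/
theorem dependsOn_childEvent (A : Set (List ι × ι → Bool)) (k : ι) :
    DependsOn (· ∈ childEvent A k) {e : List ι × ι | (e.1 ++ [e.2]).head? = some k} := by
  intro c c' hcc
  have : RandomMenger.subtree c k = RandomMenger.subtree c' k :=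
    funext fun e => hcc _ (by simp)
  simp [childEvent, this, hcc ([], k) (by simp)]

theorem IsCoinTossing.prob_forall_not_childEvent [Fintype ι] (h : IsCoinTossing P p coin)
    {A : Set (List ι × ι → Bool)} (hA : MeasurableSet A) :
    P {ω | ∀ k, (fun e => coin e ω) ∉ childEvent A k} =
      (1 - ENNReal.ofReal p * P {ω | (fun e => coin e ω) ∈ A}) ^ Fintype.card ι := by
  classical
  have := h.indep.isProbabilityMeasure
  have key : ∀ s : Finset ι, P {ω | ∀ k ∈ s, (fun e => coin e ω) ∉ childEvent A k} =
      (1 - ENNReal.ofReal p * P {ω | (fun e => coin e ω) ∈ A}) ^ s.card := by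
    intro s
    induction s using Finset.induction_on with
    | empty => simp
    | insert k s hk ih =>
      have h1 : P {ω | (fun e => coin e ω) ∈ (childEvent A k)ᶜ} =
          1 - ENNReal.ofReal p * P {ω | (fun e => coin e ω) ∈ A} := by
        rw [← h.prob_childEvent k hA]
        exact prob_compl_eq_one_sub (h.measurable_pi (measurableSet_childEvent hA k))
      rw [Finset.card_insert_of_notMem hk, pow_succ', ← ih, ← h1]
      simp only [Finset.forall_mem_insert]
      refine h.measure_inter_of_dependsOn
        (S := {e : List ι × ι | (e.1 ++ [e.2]).head? = some k})
        (T := {e : List ι × ι | ∃ l ∈ s, (e.1 ++ [e.2]).head? = some l})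
        (A := (childEvent A k)ᶜ) (B := {c | ∀ k ∈ s, c ∉ childEvent A k}) ?_
        (measurableSet_childEvent hA k).compl ?_ ?_ ?_
      · rw [Set.disjoint_left]
        rintro e he ⟨l, hl, hel⟩
        obtain rfl : k = l := Option.some_injective _ (he.symm.trans hel)
        exact hk hl
      · have : {c | ∀ k ∈ s, c ∉ childEvent A k} = ⋂ k ∈ s, (childEvent A k)ᶜ := by
          ext c; simp
        rw [this]
        exact Finset.measurableSet_biInter _ fun k _ => (measurableSet_childEvent hA k).compl
      · intro c c' hcc
        simp only [Set.mem_compl_iff]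
        exact congrArg Not (dependsOn_childEvent A k hcc)
      · intro c c' hcc
        refine propext (forall₂_congr fun l hl => not_congr (Eq.to_iff ?_))
        exact dependsOn_childEvent A l fun e he => hcc e ⟨l, hl, he⟩
  simpa using key Finset.univ

end Independence

/-! ### Zero-one law on survival, conditioning on a level, Chernoff bound -/

section Probability

variable {ι Ω : Type*} [MeasurableSpace Ω] {P : Measure Ω} {p : ℝ} {coin : List ι × ι → Ω → Bool}

/-- The strictly convex function `s ↦ (1 - p * s) ^ N` meets the line `1 - s` at `0` and at `b`,
hence lies strictly below it in between. -/
theorem eq_of_one_sub_le_pow {p a b : ℝ} {N : ℕ} (hN : 2 ≤ N) (hp : 0 < p) (hp1 : p ≤ 1)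
    (ha : 0 < a) (hab : a ≤ b) (hb : b ≤ 1) (h1 : 1 - a ≤ (1 - p * a) ^ N)
    (h2 : 1 - b = (1 - p * b) ^ N) : a = b := by
  by_contra hne
  have hlt : a < b := lt_of_le_of_ne hab hne
  have hb0 : 0 < b := ha.trans hlt
  have hpb : p * b ≤ 1 := by nlinarith
  have hab1 : a / b < 1 := (div_lt_one hb0).2 hlt
  have := (strictConvexOn_pow (n := N) hN).2
    (show 1 - p * b ∈ Set.Ici (0 : ℝ) by simpa using hpb)
    (show (1 : ℝ) ∈ Set.Ici (0 : ℝ) by simp) (by nlinarith)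
    (show 0 < a / b by positivity) (show 0 < 1 - a / b by linarith) (by ring)
  simp only [smul_eq_mul, one_pow, ← h2] at this
  have e1 : a / b * (1 - p * b) + (1 - a / b) * 1 = 1 - p * a := by field_simp; ring
  have e2 : a / b * (1 - b) + (1 - a / b) * 1 = 1 - a := by field_simp; ring
  rw [e1, e2] at this
  linarith

/-- An event that is inherited from the children of the root and implies survival has either
probability zero or the probability of survival. -/
theorem IsCoinTossing.prob_survives_diff_eq_zero [Fintype ι] (h : IsCoinTossing P p coin)
    (hι : 2 ≤ Fintype.card ι) (hp1 : p ≤ 1) {E : Set (List ι × ι → Bool)} (hE : MeasurableSet E)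
    (hES : ∀ c ∈ E, Survives c) (hchild : ∀ c k, c ∈ childEvent E k → c ∈ E)
    (hpos : P {ω | (fun e => coin e ω) ∈ E} ≠ 0) :
    P {ω | Survives (fun e => coin e ω) ∧ (fun e => coin e ω) ∉ E} = 0 := by
  have := h.indep.isProbabilityMeasure
  set V : Set (List ι × ι → Bool) := {c | Survives c} with hV
  have hVm : MeasurableSet V := measurableSet_survives
  have hEV : E ⊆ V := hES
  have hle : P {ω | (fun e => coin e ω) ∈ E} ≤ P {ω | (fun e => coin e ω) ∈ V} :=
    measure_mono fun ω hω => hEV hω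
  have hbound : ∀ {A : Set (List ι × ι → Bool)},
      (1 - ENNReal.ofReal p * P {ω | (fun e => coin e ω) ∈ A}).toReal =
        1 - max p 0 * P.real {ω | (fun e => coin e ω) ∈ A} := by
    intro A
    rw [ENNReal.toReal_sub_of_le, ENNReal.toReal_mul, ENNReal.toReal_ofReal']
    · simp [Measure.real]
    · exact mul_le_one' (by simpa using hp1) prob_le_one
    · simp
  have hcompl : ∀ {A : Set (List ι × ι → Bool)}, MeasurableSet A →
      (P {ω | (fun e => coin e ω) ∉ A}).toReal = 1 - P.real {ω | (fun e => coin e ω) ∈ A} := by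
    intro A hA
    exact probReal_compl_eq_one_sub (h.measurable_pi hA)
  have h1 : 1 - P.real {ω | (fun e => coin e ω) ∈ E} ≤
      (1 - max p 0 * P.real {ω | (fun e => coin e ω) ∈ E}) ^ Fintype.card ι := by
    rw [← hcompl hE, ← hbound, ← ENNReal.toReal_pow, ← h.prob_forall_not_childEvent hE]
    refine ENNReal.toReal_mono (measure_ne_top _ _) (measure_mono ?_)
    exact fun ω hω k hk => hω (hchild _ k hk)
  have h2 : 1 - P.real {ω | (fun e => coin e ω) ∈ V} =
      (1 - max p 0 * P.real {ω | (fun e => coin e ω) ∈ V}) ^ Fintype.card ι := by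
    rw [← hcompl hVm, ← hbound, ← ENNReal.toReal_pow, ← h.prob_forall_not_childEvent hVm]
    congr 2
    ext ω
    have := survives_iff_exists_subtree (c := fun e => coin e ω)
    simpa [childEvent, hV] using not_congr this
  have ha : 0 < P.real {ω | (fun e => coin e ω) ∈ E} :=
    ENNReal.toReal_pos hpos (measure_ne_top _ _)
  have hab : P.real {ω | (fun e => coin e ω) ∈ E} ≤ P.real {ω | (fun e => coin e ω) ∈ V} :=
    ENNReal.toReal_mono (measure_ne_top _ _) hle
  -- If `max p 0` vanished, `h2` would force survival to have probability zero, against `ha` and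
  -- `hab`.
  have hp : 0 < max p 0 := by
    rcases eq_or_lt_of_le (le_max_right p 0) with h0 | h0
    · rw [← h0] at h2
      norm_num at h2
      linarith
    · exact h0
  have heq := eq_of_one_sub_le_pow hι hp (max_le hp1 zero_le_one) ha hab measureReal_le_one h1 h2
  have hdiff := measureReal_sdiff (μ := P)
    (s₁ := {ω | (fun e => coin e ω) ∈ V}) (s₂ := {ω | (fun e => coin e ω) ∈ E})
    (fun ω hω => hEV hω) (h.measurable_pi hE)
  rw [heq, sub_self] at hdiff
  exact (measureReal_eq_zero_iff).1 hdiff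

/-- An event determined by the tosses below level `n`, followed by an event that depends on the
retained words of length `n` and on the later tosses. -/
theorem IsCoinTossing.prob_level_le [Finite ι] (h : IsCoinTossing P p coin) {n : ℕ}
    {A : Set (List ι × ι → Bool)} (hA : MeasurableSet A)
    (hAn : DependsOn (· ∈ A) {e : List ι × ι | e.1.length < n})
    {B : Finset (List ι) → Set (List ι × ι → Bool)} (hB : ∀ S, MeasurableSet (B S))
    (hBn : ∀ S, DependsOn (· ∈ B S) {e : List ι × ι | n ≤ e.1.length}) {q : ENNReal}
    (hq : ∀ c ∈ A, P {ω | (fun e => coin e ω) ∈ B (retainedFinset c n)} ≤ q) :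
    P {ω | (fun e => coin e ω) ∈ A ∧
        (fun e => coin e ω) ∈ B (retainedFinset (fun e => coin e ω) n)} ≤
      q * P {ω | (fun e => coin e ω) ∈ A} := by
  -- Once the retained set of level `n` is fixed to be `S`, the two events depend on disjoint
  -- tosses; the events `R S` are disjoint and recombine to at most `A`.
  set R : Finset (List ι) → Set (List ι × ι → Bool) := fun S =>
    A ∩ {c | retainedFinset c n = S} with hR
  have hRm : ∀ S, MeasurableSet (R S) := fun S => hA.inter (measurableSet_retainedFinset_eq n S)
  have hRn : ∀ S, DependsOn (· ∈ R S) {e : List ι × ι | e.1.length < n} := by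
    intro S c c' hcc
    have h1 : (c ∈ A) = (c' ∈ A) := hAn hcc
    have h2 : retainedFinset c n = retainedFinset c' n := retainedFinset_congr hcc
    simp [hR, h1, h2]
  calc _ ≤ P (⋃ S, {ω | (fun e => coin e ω) ∈ R S ∧ (fun e => coin e ω) ∈ B S}) := by
        refine measure_mono fun ω hω => Set.mem_iUnion.2
          ⟨retainedFinset (fun e => coin e ω) n, ⟨hω.1, rfl⟩, hω.2⟩
    _ ≤ ∑' S, P {ω | (fun e => coin e ω) ∈ R S ∧ (fun e => coin e ω) ∈ B S} :=
        measure_iUnion_le _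
    _ ≤ ∑' S, q * P {ω | (fun e => coin e ω) ∈ R S} := by
        refine ENNReal.tsum_le_tsum fun S => ?_
        rw [h.measure_inter_of_dependsOn (S := {e | e.1.length < n}) (T := {e | n ≤ e.1.length})
          ?_ (hRm S) (hB S) (hRn S) (hBn S), mul_comm]
        · rcases (R S).eq_empty_or_nonempty with h0 | ⟨c, hcA, rfl⟩
          · simp [h0]
          · exact mul_le_mul_left (hq c hcA) _
        · rw [Set.disjoint_left]
          intro e he he'
          exact (not_lt.2 (show n ≤ e.1.length from he')) he
    _ = q * P (⋃ S, {ω | (fun e => coin e ω) ∈ R S}) := by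
        rw [ENNReal.tsum_mul_left, measure_iUnion]
        · intro S T hST
          refine Set.disjoint_left.2 fun ω h1 h2 => hST (h1.2.symm.trans h2.2)
        · exact fun S => h.measurable_pi (hRm S)
    _ ≤ q * P {ω | (fun e => coin e ω) ∈ A} := by
        refine mul_le_mul_right (measure_mono ?_) q
        exact Set.iUnion_subset fun S ω hω => hω.1

theorem IsCoinTossing.prob_mem_retained_le [Finite ι] (h : IsCoinTossing P p coin) (n : ℕ)
    (w : List ι) : P {ω | w ∈ retained (fun e => coin e ω) n} ≤ ENNReal.ofReal p ^ n := by
  have := h.indep.isProbabilityMeasure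
  induction n generalizing w with
  | zero => simpa using prob_le_one
  | succ n ih =>
    rcases List.eq_nil_or_concat w with rfl | ⟨i, k, rfl⟩
    · have : {ω | [] ∈ retained (fun e => coin e ω) (n + 1)} = ∅ := by
        refine Set.eq_empty_of_forall_notMem fun ω hω => ?_
        simpa using length_of_mem_retained hω
      simp [this]
    · by_cases hi : i.length = n
      · simp only [List.concat_eq_append, append_mem_retained]
        have := h.measure_inter_of_dependsOn (S := {e | e.1.length < n}) (T := {(i, k)})
          (A := {c | i ∈ retained c n}) (B := {c | c (i, k) = true}) (by simp [hi])
          (measurableSet_mem_retained i n) (measurableSet_toss (i, k))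
          (fun c c' hcc => by simp [retained_congr hcc]) (fun c c' hcc => by simp [hcc (i, k) rfl])
        refine this.trans_le ?_
        rw [pow_succ]
        exact mul_le_mul' (ih i) (h.prob_head _).le
      · have : {ω | i.concat k ∈ retained (fun e => coin e ω) (n + 1)} = ∅ := by
          refine Set.eq_empty_of_forall_notMem fun ω hω => hi ?_
          simpa using length_of_mem_retained hω
        rw [this]
        simp

/-- The number of heads among finitely many tosses. -/
def heads (c : List ι × ι → Bool) (C : Finset (List ι × ι)) : ℕ :=
  (C.filter fun e => c e = true).card

theorem measurable_heads (C : Finset (List ι × ι)) :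
    Measurable fun c : List ι × ι → Bool => heads c C := by
  have : (fun c : List ι × ι → Bool => heads c C) =
      fun c => ∑ e ∈ C, if c e = true then 1 else 0 := by
    ext c; exact Finset.card_filter _ _
  rw [this]
  exact Finset.measurable_fun_sum _ fun e _ =>
    Measurable.ite (measurableSet_toss e) measurable_const measurable_const

/-- Chernoff bound for the lower tail of the number of heads. -/
theorem IsCoinTossing.prob_heads_le (h : IsCoinTossing P p coin) (hp0 : 0 ≤ p)
    (C : Finset (List ι × ι)) (x : ℝ) {τ : ℝ} (hτ : 0 ≤ τ) :
    P.real {ω | (heads (fun e => coin e ω) C : ℝ) ≤ x} ≤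
      Real.exp (τ * x - p * (1 - Real.exp (-τ)) * C.card) := by
  have := h.indep.isProbabilityMeasure
  let X : List ι × ι → Ω → ℝ := fun e ω => if coin e ω = true then 1 else 0
  have hXm : ∀ e, Measurable (X e) := fun e =>
    (measurable_of_countable fun b : Bool => if b = true then (1 : ℝ) else 0).comp (h.measurable e)
  have hXi : iIndepFun X P :=
    h.indep.comp (fun _ b => if b = true then (1 : ℝ) else 0) fun _ => measurable_of_countable _
  have hmgf : ∀ e, mgf (X e) P (-τ) ≤ Real.exp (-(p * (1 - Real.exp (-τ)))) := by
    intro e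
    have hfun : (fun ω => Real.exp (-τ * X e ω)) = fun ω =>
        1 - {ω | coin e ω = true}.indicator (fun _ => 1 - Real.exp (-τ)) ω := by
      ext ω
      by_cases hc : coin e ω = true <;> simp [X, hc]
    have hms : MeasurableSet {ω | coin e ω = true} :=
      h.measurable e (measurableSet_singleton true)
    rw [mgf, hfun, integral_sub (integrable_const _) ((integrable_const _).indicator hms),
      integral_indicator_const _ hms, Measure.real, h.prob_head, ENNReal.toReal_ofReal hp0]
    simp only [integral_const, probReal_univ, smul_eq_mul, mul_one]
    linarith [Real.add_one_le_exp (-(p * (1 - Real.exp (-τ))))]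
  have hsum : ∀ ω, (heads (fun e => coin e ω) C : ℝ) = (∑ e ∈ C, X e) ω := by
    intro ω
    rw [heads, Finset.card_filter]
    simp [X]
  have hint : Integrable (fun ω => Real.exp (-τ * (∑ e ∈ C, X e) ω)) P := by
    refine Integrable.of_bound (C := 1) ?_ (ae_of_all _ fun ω => ?_)
    · have : Measurable fun ω => (∑ e ∈ C, X e) ω := by
        simp only [Finset.sum_apply]
        exact Finset.measurable_sum _ fun e _ => hXm e
      fun_prop
    · rw [← hsum, Real.norm_eq_abs, Real.abs_exp, Real.exp_le_one_iff]
      have : (0 : ℝ) ≤ heads (fun e => coin e ω) C := Nat.cast_nonneg _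
      nlinarith
  have key := measure_le_le_exp_mul_mgf (X := ∑ e ∈ C, X e) x (neg_nonpos.2 hτ) hint
  simp only [hsum]
  refine key.trans ?_
  rw [hXi.mgf_sum hXm, neg_neg, sub_eq_add_neg, Real.exp_add]
  refine mul_le_mul_of_nonneg_left ?_ (Real.exp_pos _).le
  calc ∏ e ∈ C, mgf (X e) P (-τ)
      ≤ ∏ e ∈ C, Real.exp (-(p * (1 - Real.exp (-τ)))) :=
        Finset.prod_le_prod (fun e _ => mgf_nonneg) fun e _ => hmgf e
    _ = Real.exp (-(p * (1 - Real.exp (-τ)) * C.card)) := by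
        rw [Finset.prod_const, ← Real.exp_nat_mul]
        congr 1; ring

theorem IsCoinTossing.prob_forall_head_pos [Finite ι] (h : IsCoinTossing P p coin) (hp : 0 < p)
    (n : ℕ) : 0 < P {ω | ∀ e : List ι × ι, e.1.length < n → coin e ω = true} := by
  have hfin : {e : List ι × ι | e.1.length < n}.Finite := by
    have := (List.finite_length_lt ι n).prod (Set.finite_univ (α := ι))
    refine this.subset fun e he => ⟨he, trivial⟩
  have := h.indep.meas_biInter (S := hfin.toFinset) (s := fun e => {ω | coin e ω = true})
    fun e _ => ⟨{true}, measurableSet_singleton _, rfl⟩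
  have hset : {ω | ∀ e : List ι × ι, e.1.length < n → coin e ω = true} =
      ⋂ e ∈ hfin.toFinset, {ω | coin e ω = true} := by
    ext ω; simp
  rw [hset, this]
  simp only [h.prob_head, Finset.prod_const]
  exact pos_iff_ne_zero.2 (pow_ne_zero _ (ENNReal.ofReal_pos.2 hp).ne')

end Probability

/-! ### Summation over one generation -/

section Words

variable {ι : Type*} [Fintype ι]

theorem sum_retainedFinset_succ {M : Type*} [AddCommMonoid M] (c : List ι × ι → Bool) (n : ℕ)
    (f : List ι → M) :
    ∑ w ∈ retainedFinset c (n + 1), f w =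
      ∑ w ∈ retainedFinset c n, ∑ k, if c (w, k) = true then f (w ++ [k]) else 0 := by
  classical
  have hset : retainedFinset c (n + 1) =
      ((retainedFinset c n ×ˢ Finset.univ).filter fun e => c e = true).image
        fun e => e.1 ++ [e.2] := by
    ext w
    simp only [mem_retainedFinset, Finset.mem_image, Finset.mem_filter, Finset.mem_product,
      Finset.mem_univ, and_true, Prod.exists]
    constructor
    · rintro ⟨i, hi, k, hk, rfl⟩
      exact ⟨i, k, ⟨hi, hk⟩, rfl⟩
    · rintro ⟨i, k, ⟨hi, hk⟩, rfl⟩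
      exact ⟨i, hi, k, hk, rfl⟩
  rw [hset, Finset.sum_image, Finset.sum_filter, Finset.sum_product]
  rintro ⟨i, a⟩ - ⟨j, b⟩ - h
  obtain ⟨h1, h2⟩ := List.append_inj' h rfl
  simp_all

end Words

/-! ### Digit sums and the count of candidates for an address -/

section Addresses

/-- The sum of the coordinates of a digit. -/
def digitSum (k : mengerDigits) : ℤ := (k.1 0 : ℕ) + (k.1 1 : ℕ) + (k.1 2 : ℕ)

/-- The projection of the cube coded by `w` is
`[address w / 3 ^ w.length, (address w + 3) / 3 ^ w.length]`. -/
def address (w : List mengerDigits) : ℤ := w.foldl (fun a k => 3 * a + digitSum k) 0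

@[simp]
theorem address_nil : address [] = 0 := rfl

@[simp]
theorem address_append (w : List mengerDigits) (k : mengerDigits) :
    address (w ++ [k]) = 3 * address w + digitSum k := by
  simp [address]

theorem address_cons (k : mengerDigits) (w : List mengerDigits) :
    address (k :: w) = 3 ^ w.length * digitSum k + address w := by
  induction w using List.reverseRecOn with
  | nil => simp [address]
  | append_singleton w l ih =>
    rw [← List.cons_append, address_append, ih, address_append, List.length_append,
      List.length_singleton, pow_succ]
    ring

/-- The number of digits with a given coordinate sum. -/
def digitMult (z : ℤ) : ℕ := (Finset.univ.filter fun k => digitSum k = z).card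

theorem digitMult_zero : digitMult 0 = 1 := by decide
theorem digitMult_one : digitMult 1 = 3 := by decide
theorem digitMult_two : digitMult 2 = 3 := by decide
theorem digitMult_three : digitMult 3 = 6 := by decide
theorem digitMult_four : digitMult 4 = 3 := by decide
theorem digitMult_five : digitMult 5 = 3 := by decide
theorem digitMult_six : digitMult 6 = 1 := by decide

theorem digitSum_mem (k : mengerDigits) : digitSum k ∈ ({0, 1, 2, 3, 4, 5, 6} : Finset ℤ) := by
  revert k; decide

theorem sum_digitSum (f : ℤ → ℝ) :
    ∑ k, f (digitSum k) =
      f 0 + 3 * f 1 + 3 * f 2 + 6 * f 3 + 3 * f 4 + 3 * f 5 + f 6 := by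
  rw [← Finset.sum_fiberwise_of_maps_to (g := digitSum) fun k _ => digitSum_mem k]
  have : ∀ z, ∑ k with digitSum k = z, f (digitSum k) = digitMult z * f z := by
    intro z
    rw [Finset.sum_congr rfl fun k hk => by rw [(Finset.mem_filter.1 hk).2], Finset.sum_const,
      nsmul_eq_mul, digitMult]
  simp only [this]
  simp [digitMult_zero, digitMult_one, digitMult_two, digitMult_three, digitMult_four,
    digitMult_five, digitMult_six]
  ring

/-- The tosses at words of `S` whose head creates a word of address `u`. -/
def candidates (S : Finset (List mengerDigits)) (u : ℤ) :
    Finset (List mengerDigits × mengerDigits) :=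
  (S ×ˢ Finset.univ).filter fun e => 3 * address e.1 + digitSum e.2 = u

/-- The number of words of `S` with address `t`. -/
def addressCount (S : Finset (List mengerDigits)) (t : ℤ) : ℕ :=
  (S.filter fun w => address w = t).card

theorem addressCount_retainedFinset_succ (c : List mengerDigits × mengerDigits → Bool) (n : ℕ)
    (u : ℤ) :
    addressCount (retainedFinset c (n + 1)) u = heads c (candidates (retainedFinset c n) u) := by
  rw [addressCount, Finset.card_filter, sum_retainedFinset_succ, heads, candidates,
    Finset.filter_filter, Finset.card_filter, Finset.sum_product]
  refine Finset.sum_congr rfl fun w _ => Finset.sum_congr rfl fun k _ => ?_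
  by_cases h : c (w, k) = true <;> simp [h]

theorem card_candidates (S : Finset (List mengerDigits)) (u : ℤ) :
    (candidates S u).card = ∑ w ∈ S, digitMult (u - 3 * address w) := by
  rw [candidates, Finset.card_filter, Finset.sum_product]
  refine Finset.sum_congr rfl fun w _ => ?_
  rw [digitMult, Finset.card_filter]
  refine Finset.sum_congr rfl fun k _ => if_congr ?_ rfl rfl
  constructor <;> intro h <;> linarith

theorem sum_mult_le_card_candidates (S : Finset (List mengerDigits)) (j u : ℤ) :
    digitMult (u - 3 * j) * addressCount S j + digitMult (u - 3 * j + 3) * addressCount S (j - 1) +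
      digitMult (u - 3 * j + 6) * addressCount S (j - 2) ≤ (candidates S u).card := by
  simp only [card_candidates, addressCount, Finset.card_filter, Finset.mul_sum,
    ← Finset.sum_add_distrib]
  refine Finset.sum_le_sum fun w _ => ?_
  by_cases h0 : address w = j
  · have h1 : j ≠ j - 1 := by omega
    have h2 : j ≠ j - 2 := by omega
    simp [h0, h1, h2]
  by_cases h1 : address w = j - 1
  · simp [h1]
    exact le_of_eq (congrArg _ (by ring))
  by_cases h2 : address w = j - 2
  · have : j - 2 ≠ j - 1 := by omega
    simp [h2, this]
    exact le_of_eq (congrArg _ (by ring))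
  · simp [h0, h1, h2]

/-- With `r = u - 3 * j`, the three parents contribute the multiplicities of `r`, `r + 3` and `r +
6`. These add up to `1 + 6 + 1` for `r = 0` and to `3 + 3` otherwise, whence the constant 6. -/
theorem six_mul_le_card_candidates {S : Finset (List mengerDigits)} {j u : ℤ} {M : ℝ}
    (h0 : M ≤ addressCount S j) (h1 : M ≤ addressCount S (j - 1))
    (h2 : M ≤ addressCount S (j - 2)) (hu : 3 * j - 2 ≤ u) (hu' : u ≤ 3 * j + 2) :
    6 * M ≤ (candidates S u).card := by
  have key : ((digitMult (u - 3 * j) * addressCount S j +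
      digitMult (u - 3 * j + 3) * addressCount S (j - 1) +
      digitMult (u - 3 * j + 6) * addressCount S (j - 2) : ℕ) : ℝ) ≤ (candidates S u).card := by
    exact_mod_cast sum_mult_le_card_candidates S j u
  push_cast at key
  obtain ⟨r, rfl⟩ : ∃ r, u = 3 * j + r := ⟨u - 3 * j, by ring⟩
  have hr : -2 ≤ r := by linarith
  have hr' : r ≤ 2 := by linarith
  rw [add_sub_cancel_left] at key
  have n0 : (0 : ℝ) ≤ digitMult r * addressCount S j := by positivity
  have n2 : (0 : ℝ) ≤ digitMult (r + 6) * addressCount S (j - 2) := by positivity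
  interval_cases r <;>
    norm_num [digitMult_zero, digitMult_one, digitMult_two, digitMult_three, digitMult_four,
      digitMult_five, digitMult_six] at key n0 n2 ⊢ <;> linarith

end Addresses

/-! ### Projected cubes and compactness -/

section Projection

theorem proj_mengerMap (k : mengerDigits) (y : Fin 3 → ℝ) :
    proj 1 1 1 (mengerMap k y) = (digitSum k + proj 1 1 1 y) / 3 := by
  simp only [proj, mengerMap, digitSum]
  push_cast
  ring

theorem wordMap_append {ι E : Type*} (f : ι → E → E) (w : List ι) (k : ι) :
    wordMap f (w ++ [k]) = wordMap f w ∘ f k := by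
  induction w with
  | nil => rfl
  | cons l w ih => simp only [List.cons_append, wordMap, ih]; rfl

theorem proj_wordMap (w : List mengerDigits) (y : Fin 3 → ℝ) :
    proj 1 1 1 (wordMap mengerMap w y) = (address w + proj 1 1 1 y) / 3 ^ w.length := by
  induction w using List.reverseRecOn generalizing y with
  | nil => simp [wordMap]
  | append_singleton w k ih =>
    rw [wordMap_append, Function.comp_apply, ih, proj_mengerMap, address_append,
      List.length_append, List.length_singleton, pow_succ]
    push_cast
    field_simp
    ring

theorem continuous_mengerMap (k : mengerDigits) : Continuous (mengerMap k) := by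
  unfold mengerMap
  fun_prop

theorem continuous_wordMap {ι E : Type*} [TopologicalSpace E] {f : ι → E → E}
    (hf : ∀ k, Continuous (f k)) (w : List ι) : Continuous (wordMap f w) := by
  induction w with
  | nil => exact continuous_id
  | cons k w ih => exact (hf k).comp ih

/-- The `n`-th approximation of the random Menger sponge. -/
def spongeLevel (c : List mengerDigits × mengerDigits → Bool) (n : ℕ) : Set (Fin 3 → ℝ) :=
  ⋃ w ∈ retained c n, wordMap mengerMap w '' unitCube

theorem antitone_spongeLevel (c : List mengerDigits × mengerDigits → Bool) :
    Antitone (spongeLevel c) := by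
  refine antitone_nat_of_succ_le fun n => ?_
  refine Set.iUnion₂_subset fun w hw => ?_
  obtain ⟨i, hi, k, -, rfl⟩ := hw
  rw [wordMap_append, Set.image_comp]
  exact (Set.image_mono (mengerMap_image_subset k)).trans
    (Set.subset_biUnion_of_mem (u := fun w => wordMap mengerMap w '' unitCube) hi)

theorem isCompact_spongeLevel (c : List mengerDigits × mengerDigits → Bool) (n : ℕ) :
    IsCompact (spongeLevel c n) :=
  (finite_retained c n).isCompact_biUnion fun w _ =>
    isCompact_unitCube.image (continuous_wordMap continuous_mengerMap w)

theorem mem_proj_spongeLevel_iff {c : List mengerDigits × mengerDigits → Bool} {n : ℕ} {x : ℝ} :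
    x ∈ proj 1 1 1 '' spongeLevel c n ↔
      ∃ w ∈ retained c n, (address w : ℝ) ≤ 3 ^ n * x ∧ 3 ^ n * x ≤ address w + 3 := by
  constructor
  · rintro ⟨y, hy, rfl⟩
    obtain ⟨w, hw, z, hz, rfl⟩ := Set.mem_iUnion₂.1 hy
    refine ⟨w, hw, ?_⟩
    rw [proj_wordMap, length_of_mem_retained hw, mul_div_cancel₀ _ (by positivity)]
    have h0 := hz 0
    have h1 := hz 1
    have h2 := hz 2
    simp only [proj]
    constructor <;> linarith
  · rintro ⟨w, hw, h1, h2⟩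
    -- A preimage is taken on the diagonal of the cube.
    set z : ℝ := (3 ^ n * x - address w) / 3 with hz
    refine ⟨wordMap mengerMap w fun _ => z, Set.mem_biUnion hw ⟨_, fun _ => ⟨?_, ?_⟩, rfl⟩, ?_⟩
    · rw [hz]; linarith
    · rw [hz]; linarith
    · rw [proj_wordMap, length_of_mem_retained hw, div_eq_iff (by positivity), proj, hz]
      ring

/-- By compactness, the fibres over `x` in the nested levels have a common point, so projection
commutes with this decreasing intersection. -/
theorem mem_proj_mengerSponge {c : List mengerDigits × mengerDigits → Bool} {x : ℝ} {m : ℕ}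
    (h : ∀ k, x ∈ proj 1 1 1 '' spongeLevel c (m + k)) : x ∈ proj 1 1 1 '' mengerSponge c := by
  have hcont : Continuous (proj 1 1 1) := by unfold proj; fun_prop
  have hclosed : IsClosed (proj 1 1 1 ⁻¹' {x}) := isClosed_singleton.preimage hcont
  obtain ⟨y, hy⟩ := IsCompact.nonempty_iInter_of_sequence_nonempty_isCompact_isClosed
    (fun k => spongeLevel c (m + k) ∩ proj 1 1 1 ⁻¹' {x})
    (fun k => Set.inter_subset_inter_left _ (antitone_spongeLevel c (Nat.le_succ _)))
    (fun k => by
      obtain ⟨y, hy, hyx⟩ := h k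
      exact ⟨y, hy, hyx⟩)
    ((isCompact_spongeLevel c _).inter_right hclosed)
    fun k => (isCompact_spongeLevel c _).isClosed.inter hclosed
  rw [Set.mem_iInter] at hy
  exact ⟨y, Set.mem_iInter₂.2 fun n _ => antitone_spongeLevel c (Nat.le_add_left n m) (hy n).1,
    (hy 0).2⟩

theorem proj_mengerSponge_subset (c : List mengerDigits × mengerDigits → Bool) {n : ℕ}
    (hn : 1 ≤ n) : proj 1 1 1 '' mengerSponge c ⊆ proj 1 1 1 '' spongeLevel c n :=
  Set.image_mono (Set.iInter₂_subset n hn)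

end Projection

/-! ### First moment at triadic points for `p < 1/6` -/

section Subcritical

variable {Ω : Type*} [MeasurableSpace Ω] {P : Measure Ω} {p : ℝ}
  {coin : List mengerDigits × mengerDigits → Ω → Bool}

/-- The weights of the offsets of a triadic point in the projected cubes. -/
def offsetWeight (ε : ℝ) (d : ℤ) : ℝ :=
  if d = 0 ∨ d = 3 then ε else if d = 1 ∨ d = 2 then 1 else 0

theorem offsetWeight_nonneg {ε : ℝ} (hε : 0 ≤ ε) (d : ℤ) : 0 ≤ offsetWeight ε d := by
  unfold offsetWeight
  split_ifs <;> norm_num [hε]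

/-- The inner offsets 1 and 2 have three children at each inner offset and `6 + 1` at the end
offsets 0 and 3, giving `6 + 7 * ε`. An end offset has only one child of nonzero weight, at the same
offset. The small weight `ε` thus makes the growth rate as close to 6 as desired. -/
theorem sum_offsetWeight_le {ε : ℝ} (hε : 0 ≤ ε) (d : ℤ) :
    ∑ k, offsetWeight ε (3 * d - digitSum k) ≤ (6 + 7 * ε) * offsetWeight ε d := by
  rw [sum_digitSum fun z => offsetWeight ε (3 * d - z)]
  rcases le_or_gt d (-1) with h | h
  · have : ∀ z : ℤ, 0 ≤ z → offsetWeight ε (3 * d - z) = 0 := fun z hz => by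
      rw [offsetWeight, if_neg (by omega), if_neg (by omega)]
    simp only [this _ (show (0 : ℤ) ≤ 0 by norm_num), this 1 (by norm_num), this 2 (by norm_num),
      this 3 (by norm_num), this 4 (by norm_num), this 5 (by norm_num), this 6 (by norm_num)]
    have := offsetWeight_nonneg hε d
    norm_num
    positivity
  rcases le_or_gt 4 d with h' | h'
  · have : ∀ z : ℤ, z ≤ 6 → offsetWeight ε (3 * d - z) = 0 := fun z hz => by
      rw [offsetWeight, if_neg (by omega), if_neg (by omega)]
    simp only [this 0 (by norm_num), this 1 (by norm_num), this 2 (by norm_num),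
      this 3 (by norm_num), this 4 (by norm_num), this 5 (by norm_num), this 6 (by norm_num)]
    have := offsetWeight_nonneg hε d
    norm_num
    positivity
  · interval_cases d <;> norm_num [offsetWeight] <;> nlinarith

theorem sum_offsetWeight_level_le {ε : ℝ} (hε : 0 ≤ ε) (m : ℕ) (j : ℤ) (k : ℕ) :
    ∑ w ∈ retainedFinset (fun _ => true) (m + k), offsetWeight ε (3 ^ k * j - address w) ≤
      (6 + 7 * ε) ^ k *
        ∑ w ∈ retainedFinset (fun _ => true) m, offsetWeight ε (j - address w) := by
  induction k with
  | zero => simp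
  | succ k ih =>
    rw [← add_assoc, sum_retainedFinset_succ]
    calc _ ≤ ∑ w ∈ retainedFinset (fun _ => true) (m + k),
          (6 + 7 * ε) * offsetWeight ε (3 ^ k * j - address w) := by
          refine Finset.sum_le_sum fun w _ => ?_
          refine le_trans (le_of_eq ?_) (sum_offsetWeight_le hε _)
          refine Finset.sum_congr rfl fun l _ => ?_
          rw [if_pos rfl, address_append]
          congr 1
          ring
      _ ≤ _ := by
          rw [← Finset.mul_sum, pow_succ', mul_assoc]
          exact mul_le_mul_of_nonneg_left ih (by positivity)

theorem mem_retained_true_of_mem_retained {ι : Type*} {c : List ι × ι → Bool} {n : ℕ} {w : List ι}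
    (h : w ∈ retained c n) : w ∈ retained (fun _ => true) n := by
  induction n generalizing w with
  | zero => exact h
  | succ n ih =>
    obtain ⟨i, hi, k, -, rfl⟩ := h
    exact ⟨i, ih hi, k, rfl, rfl⟩

theorem IsCoinTossing.prob_triadic_mem_level_le (h : IsCoinTossing P p coin) (hp0 : 0 ≤ p) {ε : ℝ}
    (hε : 0 < ε) (hε1 : ε ≤ 1) (m : ℕ) (j : ℤ) (k : ℕ) :
    P {ω | (j : ℝ) / 3 ^ m ∈ proj 1 1 1 '' spongeLevel (fun e => coin e ω) (m + k)} ≤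
      ENNReal.ofReal (p ^ (m + k) * (ε⁻¹ * ((6 + 7 * ε) ^ k *
        ∑ w ∈ retainedFinset (fun _ => true) m, offsetWeight ε (j - address w)))) := by
  classical
  set F := (retainedFinset (fun _ => true) (m + k)).filter fun w : List mengerDigits =>
    address w ≤ 3 ^ k * j ∧ 3 ^ k * j ≤ address w + 3 with hF
  have hsub : {ω | (j : ℝ) / 3 ^ m ∈ proj 1 1 1 '' spongeLevel (fun e => coin e ω) (m + k)} ⊆
      ⋃ w ∈ F, {ω | w ∈ retained (fun e => coin e ω) (m + k)} := by
    intro ω hω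
    obtain ⟨w, hw, h1, h2⟩ := mem_proj_spongeLevel_iff.1 hω
    have e : (3 : ℝ) ^ (m + k) * (j / 3 ^ m) = ((3 ^ k * j : ℤ) : ℝ) := by
      push_cast
      rw [pow_add]
      field_simp
    rw [e] at h1 h2
    refine Set.mem_biUnion (x := w) ?_ hw
    simp only [hF, Finset.coe_filter, Set.mem_ofPred_eq, mem_retainedFinset]
    exact ⟨mem_retained_true_of_mem_retained hw, by exact_mod_cast h1, by exact_mod_cast h2⟩
  have hcard : (F.card : ℝ) ≤ ε⁻¹ * ((6 + 7 * ε) ^ k *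
        ∑ w ∈ retainedFinset (fun _ => true) m, offsetWeight ε (j - address w)) := by
    refine le_trans ?_ (mul_le_mul_of_nonneg_left (sum_offsetWeight_level_le hε.le m j k)
      (by positivity))
    rw [hF, Finset.card_filter, Finset.mul_sum]
    push_cast
    refine Finset.sum_le_sum fun w _ => ?_
    split_ifs with hw
    -- A cube over the point has offset 0, 1, 2 or 3, hence weight at least `ε`; this is the source
    -- of the factor `ε⁻¹`.
    · have hd : 0 ≤ 3 ^ k * j - address w := by linarith
      have hd' : 3 ^ k * j - address w ≤ 3 := by linarith
      rw [le_inv_mul_iff₀ hε, mul_one]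
      generalize 3 ^ k * j - address w = d at hd hd'
      interval_cases d <;> norm_num [offsetWeight, hε1]
    · exact mul_nonneg (by positivity) (offsetWeight_nonneg hε.le _)
  calc _ ≤ ∑ w ∈ F, P {ω | w ∈ retained (fun e => coin e ω) (m + k)} :=
        (measure_mono hsub).trans (measure_biUnion_finset_le _ _)
    _ ≤ ∑ w ∈ F, ENNReal.ofReal p ^ (m + k) :=
        Finset.sum_le_sum fun w _ => h.prob_mem_retained_le _ w
    _ = ENNReal.ofReal (p ^ (m + k) * F.card) := by
        rw [Finset.sum_const, nsmul_eq_mul, mul_comm, ENNReal.ofReal_mul (by positivity),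
          ENNReal.ofReal_pow hp0, ENNReal.ofReal_natCast]
    _ ≤ _ := ENNReal.ofReal_le_ofReal (mul_le_mul_of_nonneg_left hcard (by positivity))

theorem IsCoinTossing.ae_triadic_notMem (h : IsCoinTossing P p coin) (hp0 : 0 ≤ p)
    (hp : p < 1 / 6) (m : ℕ) (j : ℤ) :
    ∀ᵐ ω ∂P, (j : ℝ) / 3 ^ m ∉ proj 1 1 1 '' mengerSponge fun e => coin e ω := by
  -- With this `ε`, `7 * ε` is half of the gap `1 - 6 * p`, so `p * (6 + 7 * ε)` stays below 1.
  have hε : 0 < (1 - 6 * p) / 14 := by linarith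
  set ε := (1 - 6 * p) / 14 with hεdef
  have hlt : p * (6 + 7 * ε) < 1 := by nlinarith
  set K := ∑ w ∈ retainedFinset (fun _ => true) m, offsetWeight ε (j - address w)
  have hlim : Filter.Tendsto (fun k => ENNReal.ofReal (p ^ (m + k) * (ε⁻¹ * ((6 + 7 * ε) ^ k * K))))
      Filter.atTop (nhds 0) := by
    have h1 := tendsto_pow_atTop_nhds_zero_of_lt_one (by positivity) hlt
    have h2 := ENNReal.tendsto_ofReal (h1.const_mul (p ^ m * ε⁻¹ * K))
    rw [mul_zero, ENNReal.ofReal_zero] at h2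
    refine h2.congr fun k => ?_
    congr 1
    rw [mul_pow, pow_add]
    ring
  rw [ae_iff]
  simp only [not_not]
  refine le_antisymm (ge_of_tendsto hlim ?_) zero_le
  filter_upwards [Filter.eventually_ge_atTop 1] with k hk
  refine le_trans (measure_mono fun ω hω => ?_)
    (h.prob_triadic_mem_level_le hp0 hε (by linarith) m j k)
  exact proj_mengerSponge_subset _ (by omega) hω

theorem exists_triadic_mem_Icc {a b : ℝ} (hab : a < b) :
    ∃ (m : ℕ) (j : ℤ), (j : ℝ) / 3 ^ m ∈ Set.Icc a b := by
  obtain ⟨m, hm⟩ := exists_pow_lt_of_lt_one (sub_pos.2 hab) (show (1 / 3 : ℝ) < 1 by norm_num)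
  refine ⟨m, ⌈3 ^ m * a⌉, ?_, ?_⟩
  · rw [le_div_iff₀' (by positivity)]
    exact Int.le_ceil _
  · rw [div_le_iff₀' (by positivity)]
    have h1 := (Int.ceil_lt_add_one (3 ^ m * a)).le
    have h2 : (3 : ℝ) ^ m * (1 / 3) ^ m = 1 := by rw [← mul_pow]; norm_num
    have h3 : (3 : ℝ) ^ m * (1 / 3) ^ m < 3 ^ m * (b - a) :=
      mul_lt_mul_of_pos_left hm (by positivity)
    nlinarith

theorem IsCoinTossing.ae_not_containsInterval (h : IsCoinTossing P p coin) (hp0 : 0 ≤ p)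
    (hp : p < 1 / 6) :
    ∀ᵐ ω ∂P, ¬ ContainsInterval (proj 1 1 1 '' mengerSponge fun e => coin e ω) := by
  have := ae_all_iff.2 fun m => ae_all_iff.2 fun j => h.ae_triadic_notMem hp0 hp m j
  filter_upwards [this] with ω hω
  rintro ⟨a, b, hab, hsub⟩
  obtain ⟨m, j, hj⟩ := exists_triadic_mem_Icc hab
  exact hω m j (hsub hj)

end Subcritical

/-! ### A measurable, inherited event that forces an interval -/

section Cover

/-- The projections of the retained cubes cover a fixed triadic interval at every level. -/
def coverEvent : Set (List mengerDigits × mengerDigits → Bool) :=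
  {c | ∃ (m : ℕ) (j : ℤ), ∀ (k : ℕ) (i : ℤ), 0 ≤ i → i < 3 ^ k →
    ∃ w ∈ retained c (m + k), address w ≤ 3 ^ k * j + i ∧ 3 ^ k * j + i ≤ address w + 2}

theorem measurableSet_coverEvent : MeasurableSet coverEvent := by
  have : coverEvent = ⋃ (m : ℕ) (j : ℤ), ⋂ (k : ℕ) (i : ℤ) (_ : 0 ≤ i) (_ : i < 3 ^ k),
      ⋃ w, {c | w ∈ retained c (m + k)} ∩
        {_c | address w ≤ 3 ^ k * j + i ∧ 3 ^ k * j + i ≤ address w + 2} := by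
    ext c
    simp [coverEvent]
  rw [this]
  exact .iUnion fun m => .iUnion fun j => .iInter fun k => .iInter fun i => .iInter fun _ =>
    .iInter fun _ => .iUnion fun w => (measurableSet_mem_retained w _).inter (.const _)

theorem survives_of_mem_coverEvent {c : List mengerDigits × mengerDigits → Bool}
    (hc : c ∈ coverEvent) : Survives c := by
  obtain ⟨m, j, h⟩ := hc
  intro n
  obtain ⟨w, hw, -⟩ := h n 0 le_rfl (by positivity)
  exact retained_nonempty_of_le (Nat.le_add_left n m) ⟨w, hw⟩

/-- Prefixing a letter only shifts all addresses, so the covered cell of the child becomes a covered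
cell one level deeper. -/
theorem mem_coverEvent_of_mem_childEvent {c : List mengerDigits × mengerDigits → Bool}
    {l : mengerDigits} (h : c ∈ childEvent coverEvent l) : c ∈ coverEvent := by
  obtain ⟨hl, m, j, h⟩ := h
  refine ⟨m + 1, 3 ^ m * digitSum l + j, fun k i hi hik => ?_⟩
  obtain ⟨w, hw, h1, h2⟩ := h k i hi hik
  rw [show m + 1 + k = m + k + 1 by omega]
  refine ⟨l :: w, cons_mem_retained.2 ⟨hl, hw⟩, ?_⟩
  have : address (l :: w) = 3 ^ k * (3 ^ m * digitSum l) + address w := by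
    rw [address_cons, length_of_mem_retained hw, pow_add]
    ring
  rw [this]
  constructor <;> linarith

theorem containsInterval_of_mem_coverEvent {c : List mengerDigits × mengerDigits → Bool}
    (hc : c ∈ coverEvent) : ContainsInterval (proj 1 1 1 '' mengerSponge c) := by
  obtain ⟨m, j, h⟩ := hc
  -- Only half of the cell is used, so that the integer part of `3 ^ (m + k) * x` stays strictly
  -- below the right end of the cell.
  refine ⟨j / 3 ^ m, (j + 1 / 2) / 3 ^ m, by gcongr; linarith, fun x hx => ?_⟩
  refine mem_proj_mengerSponge (m := m) fun k => mem_proj_spongeLevel_iff.2 ?_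
  have h3k : (0 : ℝ) < 3 ^ k := by positivity
  have h1 : 3 ^ k * (j : ℝ) ≤ 3 ^ (m + k) * x := by
    have := (div_le_iff₀' (by positivity)).1 hx.1
    rw [pow_add, mul_comm (3 ^ m : ℝ), mul_assoc]
    exact mul_le_mul_of_nonneg_left this h3k.le
  have h2 : 3 ^ (m + k) * x < 3 ^ k * j + 3 ^ k := by
    have := (le_div_iff₀' (by positivity)).1 hx.2
    rw [pow_add, mul_comm (3 ^ m : ℝ), mul_assoc]
    have := mul_le_mul_of_nonneg_left this h3k.le
    linarith
  obtain ⟨w, hw, hw1, hw2⟩ := h k (⌊3 ^ (m + k) * x⌋ - 3 ^ k * j)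
    (sub_nonneg.2 (Int.le_floor.2 (by push_cast; exact h1)))
    (by
      rw [sub_lt_iff_lt_add', Int.floor_lt]
      push_cast
      exact h2)
  rw [add_sub_cancel] at hw1 hw2
  refine ⟨w, hw, Int.le_floor.1 hw1, ?_⟩
  have hw2' : (⌊3 ^ (m + k) * x⌋ : ℝ) ≤ address w + 2 := by exact_mod_cast hw2
  linarith [Int.lt_floor_add_one (3 ^ (m + k) * x)]

end Cover

/-! ### Exponential growth of address counts for `p > 1/6` -/

section Growth

variable {Ω : Type*} [MeasurableSpace Ω] {P : Measure Ω} {p : ℝ}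
  {coin : List mengerDigits × mengerDigits → Ω → Bool}

theorem length_of_mem_candidates {S : Finset (List mengerDigits)} {n : ℕ} {u : ℤ}
    (hS : ∀ w ∈ S, w.length = n) {e : List mengerDigits × mengerDigits}
    (he : e ∈ candidates S u) : e.1.length = n :=
  hS _ (Finset.mem_product.1 (Finset.mem_filter.1 he).1).1

/-- In the full tree, the addresses 0, 1, 2 occur at level 1, and each further level multiplies the
minimal count over the window of three addresses by at least 6. This supplies the initial abundance.
-/
theorem six_pow_le_addressCount {c : List mengerDigits × mengerDigits → Bool} {m : ℕ}
    (hc : ∀ e, e.1.length < m + 1 → c e = true) {t : ℤ} (ht : 2 * 3 ^ m - 2 ≤ t)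
    (ht' : t ≤ 2 * 3 ^ m) : (6 : ℝ) ^ m ≤ addressCount (retainedFinset c (m + 1)) t := by
  have hheads : ∀ n ≤ m, ∀ u,
      addressCount (retainedFinset c (n + 1)) u = (candidates (retainedFinset c n) u).card := by
    intro n hn u
    rw [addressCount_retainedFinset_succ, heads, Finset.filter_true_of_mem]
    intro e he
    refine hc e ?_
    rw [length_of_mem_candidates (fun w hw => length_of_mem_retained (mem_retainedFinset.1 hw)) he]
    omega
  induction m generalizing t with
  | zero =>
    have : retainedFinset c 0 = {[]} := by ext w; simp [retained]
    rw [hheads 0 le_rfl, card_candidates, this, Finset.sum_singleton, address_nil, mul_zero,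
      sub_zero]
    norm_num at ht ht'
    interval_cases t <;> norm_num [digitMult_zero, digitMult_one, digitMult_two]
  | succ m ih =>
    have ih := fun t => @ih (fun e he => hc e (by omega)) t
    rw [hheads _ le_rfl, pow_succ']
    rw [pow_succ] at ht ht'
    refine six_mul_le_card_candidates (j := 2 * 3 ^ m)
      (ih _ ?_ ?_ ?_) (ih _ ?_ ?_ ?_) (ih _ ?_ ?_ ?_) ?_ ?_
    all_goals first
      | exact fun n hn u => hheads n (by omega) u
      | omega

/-- All addresses needed to cover the descendants of the cell `j` after `k` more steps occur at
least `M * γ ^ k` times. -/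
def abundant (m : ℕ) (j : ℤ) (M γ : ℝ) (k : ℕ) : Set (List mengerDigits × mengerDigits → Bool) :=
  {c | ∀ t ∈ Finset.Ico (3 ^ k * j - 2) (3 ^ k * j + 3 ^ k),
    M * γ ^ k ≤ addressCount (retainedFinset c (m + k)) t}

theorem measurableSet_abundant (m : ℕ) (j : ℤ) (M γ : ℝ) (k : ℕ) :
    MeasurableSet (abundant m j M γ k) := by
  have : abundant m j M γ k = ⋃ S, {c | retainedFinset c (m + k) = S} ∩
      {_c | ∀ t ∈ Finset.Ico (3 ^ k * j - 2) (3 ^ k * j + 3 ^ k),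
        M * γ ^ k ≤ addressCount S t} := by
    ext c
    simp [abundant]
  rw [this]
  exact .iUnion fun S => (measurableSet_retainedFinset_eq _ S).inter (.const _)

/-- The cells stay abundant during the first `k` steps. -/
def abundantUpTo (m : ℕ) (j : ℤ) (M γ : ℝ) (k : ℕ) :
    Set (List mengerDigits × mengerDigits → Bool) :=
  ⋂ i ≤ k, abundant m j M γ i

theorem measurableSet_abundantUpTo (m : ℕ) (j : ℤ) (M γ : ℝ) (k : ℕ) :
    MeasurableSet (abundantUpTo m j M γ k) :=
  .iInter fun _ => .iInter fun _ => measurableSet_abundant ..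

theorem dependsOn_abundantUpTo (m : ℕ) (j : ℤ) (M γ : ℝ) (k : ℕ) :
    DependsOn (· ∈ abundantUpTo m j M γ k)
      {e : List mengerDigits × mengerDigits | e.1.length < m + k} := by
  intro c c' hcc
  have : ∀ i ≤ k, retainedFinset c (m + i) = retainedFinset c' (m + i) := fun i hi =>
    retainedFinset_congr fun e he => hcc e (show e.1.length < m + k by omega)
  simp only [abundantUpTo, abundant, Set.mem_iInter, Set.mem_ofPred_eq, eq_iff_iff]
  refine forall₂_congr fun i hi => ?_
  rw [this i hi]

theorem six_mul_le_card_candidates_of_mem_abundant {m : ℕ} {j : ℤ} {M γ : ℝ} {k : ℕ}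
    {c : List mengerDigits × mengerDigits → Bool} (hc : c ∈ abundant m j M γ k) {t : ℤ}
    (ht : t ∈ Finset.Ico (3 ^ (k + 1) * j - 2) (3 ^ (k + 1) * j + 3 ^ (k + 1))) :
    6 * (M * γ ^ k) ≤ (candidates (retainedFinset c (m + k)) t).card := by
  obtain ⟨h1, h2⟩ := Finset.mem_Ico.1 ht
  have e : (3 : ℤ) ^ (k + 1) * j = 3 * (3 ^ k * j) := by ring
  have e' : (3 : ℤ) ^ (k + 1) = 3 * 3 ^ k := by ring
  rw [e] at h1 h2
  rw [e'] at h2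
  simp only [abundant, Set.mem_ofPred_eq, Finset.mem_Ico] at hc
  have hk : (0 : ℤ) < 3 ^ k := by positivity
  generalize (3 : ℤ) ^ k * j = L at *
  generalize (3 : ℤ) ^ k = N at *
  -- The largest relevant parent is `t / 3`, except for the two addresses left of `3 * L`, where `L`
  -- is used. In both cases three consecutive parents lie in the abundant window, which is why that
  -- window starts at `L - 2`.
  refine six_mul_le_card_candidates (j := max L (t / 3)) (hc _ ?_) (hc _ ?_) (hc _ ?_) ?_ ?_ <;>
    omega

theorem dependsOn_heads {ι : Type*} {C : Finset (List ι × ι)} {T : Set (List ι × ι)}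
    (hC : ∀ e ∈ C, e ∈ T) : DependsOn (fun c => heads c C) T := by
  intro c c' hcc
  refine congrArg Finset.card (Finset.filter_congr fun e he => ?_)
  rw [hcc e (hC e he)]

theorem IsCoinTossing.prob_abundantUpTo_diff_le (h : IsCoinTossing P p coin) (hp0 : 0 ≤ p)
    {τ γ M : ℝ} (hτ : 0 ≤ τ) (m : ℕ) (j : ℤ) (k : ℕ) :
    P {ω | (fun e => coin e ω) ∈ abundantUpTo m j M γ k ∧
        (fun e => coin e ω) ∉ abundant m j M γ (k + 1)} ≤
      ENNReal.ofReal (3 ^ (k + 2) *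
        Real.exp (-((6 * p * (1 - Real.exp (-τ)) - τ * γ) * (M * γ ^ k)))) *
        P {ω | (fun e => coin e ω) ∈ abundantUpTo m j M γ k} := by
  classical
  have := h.indep.isProbabilityMeasure
  set I := Finset.Ico ((3 : ℤ) ^ (k + 1) * j - 2) (3 ^ (k + 1) * j + 3 ^ (k + 1)) with hI
  -- The filter is void on a retained set; it makes `B S` depend only on tosses at level `m + k` for
  -- every `S`.
  let B : Finset (List mengerDigits) → Set (List mengerDigits × mengerDigits → Bool) := fun S =>
    ⋃ t ∈ I, {c | (heads c (candidates (S.filter fun w => w.length = m + k) t) : ℝ) ≤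
      M * γ ^ (k + 1)}
  have hfilter : ∀ c : List mengerDigits × mengerDigits → Bool,
      (retainedFinset c (m + k)).filter (fun w => w.length = m + k) = retainedFinset c (m + k) :=
    fun c => Finset.filter_true_of_mem fun w hw =>
      length_of_mem_retained (mem_retainedFinset.1 hw)
  have hB : ∀ S, MeasurableSet (B S) := fun S => Finset.measurableSet_biUnion _ fun t _ => by
    have := (measurable_of_countable fun n : ℕ => (n : ℝ)).comp
      (measurable_heads (candidates (S.filter fun w => w.length = m + k) t))
    exact measurableSet_le this measurable_const
  have hBn : ∀ S, DependsOn (· ∈ B S)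
      {e : List mengerDigits × mengerDigits | m + k ≤ e.1.length} := by
    intro S c c' hcc
    have : ∀ t, heads c (candidates (S.filter fun w => w.length = m + k) t) =
        heads c' (candidates (S.filter fun w => w.length = m + k) t) := fun t =>
      dependsOn_heads (fun e he =>
        (length_of_mem_candidates (fun w hw => (Finset.mem_filter.1 hw).2) he).ge) hcc
    simp [B, this]
  refine le_trans (measure_mono ?_) (h.prob_level_le (n := m + k)
    (measurableSet_abundantUpTo m j M γ k) (dependsOn_abundantUpTo m j M γ k) hB hBn ?_)
  · rintro ω ⟨h1, h2⟩
    refine ⟨h1, ?_⟩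
    simp only [abundant, Set.mem_ofPred_eq, not_forall, not_le] at h2
    obtain ⟨t, ht, hlt⟩ := h2
    refine Set.mem_biUnion ht ?_
    rw [← add_assoc, addressCount_retainedFinset_succ] at hlt
    simp only [hfilter, Set.mem_ofPred_eq]
    exact hlt.le
  · intro c hc
    simp only [B, hfilter]
    have hk : c ∈ abundant m j M γ k := Set.mem_iInter₂.1 hc k le_rfl
    set x := Real.exp (-((6 * p * (1 - Real.exp (-τ)) - τ * γ) * (M * γ ^ k))) with hx
    have hone : ∀ t ∈ I, P {ω | (heads (fun e => coin e ω)
        (candidates (retainedFinset c (m + k)) t) : ℝ) ≤ M * γ ^ (k + 1)} ≤ ENNReal.ofReal x := by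
      intro t ht
      rw [← ENNReal.ofReal_toReal (measure_ne_top P {ω | (heads (fun e => coin e ω)
        (candidates (retainedFinset c (m + k)) t) : ℝ) ≤ M * γ ^ (k + 1)})]
      refine ENNReal.ofReal_le_ofReal ((h.prob_heads_le hp0 _ _ hτ).trans ?_)
      rw [hx, Real.exp_le_exp]
      have hcard := six_mul_le_card_candidates_of_mem_abundant hk ht
      have hτ1 : 0 ≤ p * (1 - Real.exp (-τ)) :=
        mul_nonneg hp0 (sub_nonneg.2 (Real.exp_le_one_iff.2 (by linarith)))
      have := mul_le_mul_of_nonneg_left hcard hτ1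
      rw [pow_succ]
      linarith
    have hcardI : (I.card : ℝ) ≤ 3 ^ (k + 2) := by
      have h3 : (1 : ℕ) ≤ 3 ^ k := Nat.one_le_pow _ _ (by norm_num)
      have : I.card = 3 ^ (k + 1) + 2 := by
        rw [hI, Int.card_Ico]
        have : (3 : ℤ) ^ (k + 1) * j + 3 ^ (k + 1) - (3 ^ (k + 1) * j - 2) =
            ((3 ^ (k + 1) + 2 : ℕ) : ℤ) := by push_cast; ring
        rw [this, Int.toNat_natCast]
      rw [this]
      have : 3 ^ (k + 1) + 2 ≤ 3 ^ (k + 2) := by rw [pow_succ, pow_add]; omega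
      exact_mod_cast this
    calc P {ω | (fun e => coin e ω) ∈ ⋃ t ∈ I, {d | (heads d
            (candidates (retainedFinset c (m + k)) t) : ℝ) ≤ M * γ ^ (k + 1)}}
        ≤ ∑ t ∈ I, P {ω | (heads (fun e => coin e ω)
            (candidates (retainedFinset c (m + k)) t) : ℝ) ≤ M * γ ^ (k + 1)} := by
          refine le_trans (measure_mono fun ω hω => ?_) (measure_biUnion_finset_le I _)
          simpa using hω
      _ ≤ ∑ t ∈ I, ENNReal.ofReal x := Finset.sum_le_sum hone
      _ = ENNReal.ofReal (I.card * x) := by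
          rw [Finset.sum_const, nsmul_eq_mul, ENNReal.ofReal_mul (by positivity),
            ENNReal.ofReal_natCast]
      _ ≤ _ := ENNReal.ofReal_le_ofReal
          (mul_le_mul_of_nonneg_right hcardI (Real.exp_pos _).le)

/-- For `τ = γ - 1`, the bound `exp τ ≥ 1 + τ = γ` gives `1 - exp (-τ) ≥ (γ - 1) / γ`, and the claim
reduces to `γ ^ 2 < 6 * p`. -/
theorem exists_growth_parameters (hp : 1 / 6 < p) :
    ∃ τ γ : ℝ, 0 ≤ τ ∧ 1 < γ ∧ 0 < 6 * p * (1 - Real.exp (-τ)) - τ * γ := by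
  obtain ⟨γ, h1, h2⟩ : ∃ γ : ℝ, 1 < γ ∧ γ ^ 2 < 6 * p := by
    obtain ⟨γ, h1, h2⟩ := exists_between
      (show 1 < Real.sqrt (6 * p) from Real.lt_sqrt_of_sq_lt (by linarith))
    exact ⟨γ, h1, (Real.lt_sqrt (by linarith)).1 h2⟩
  refine ⟨γ - 1, γ, by linarith, h1, ?_⟩
  have hγ : 0 < γ := by linarith
  have hexp : Real.exp (-(γ - 1)) ≤ 1 / γ := by
    rw [Real.exp_neg, ← one_div]
    exact one_div_le_one_div_of_le hγ (by linarith [Real.add_one_le_exp (γ - 1)])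
  have h3 : (γ - 1) / γ ≤ 1 - Real.exp (-(γ - 1)) := by
    rw [sub_div, div_self hγ.ne']
    linarith
  have h4 : (γ - 1) * γ < 6 * p * ((γ - 1) / γ) := by
    rw [mul_div_assoc', lt_div_iff₀ hγ]
    nlinarith
  nlinarith

theorem exists_scale {δ γ : ℝ} (hδ : 0 < δ) (hγ : 1 < γ) :
    ∃ m : ℕ, ∀ k : ℕ, 3 ^ (k + 2) * Real.exp (-(δ * (6 ^ m * γ ^ k))) ≤ (1 / 2 : ℝ) ^ (k + 2) := by
  obtain ⟨m, hm⟩ := pow_unbounded_of_one_lt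
    (max (2 * Real.log 6 / δ) (Real.log 6 / (δ * (γ - 1)))) (show (1 : ℝ) < 6 by norm_num)
  refine ⟨m, fun k => ?_⟩
  -- By Bernoulli's inequality `γ ^ k` is at least affine in `k`; `h1` handles its constant term and
  -- `h2` its slope, so the exponential is at most `(1 / 6) ^ (k + 2)`.
  have h1 : 2 * Real.log 6 ≤ 6 ^ m * δ := (div_le_iff₀ hδ).1 ((le_max_left _ _).trans hm.le)
  have h2 : Real.log 6 ≤ 6 ^ m * (δ * (γ - 1)) :=
    (div_le_iff₀ (mul_pos hδ (by linarith))).1 ((le_max_right _ _).trans hm.le)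
  have hb : 1 + k * (γ - 1) ≤ γ ^ k := by
    have := one_add_mul_le_pow (a := γ - 1) (by linarith) k
    simpa using this
  have h3 : (k + 2 : ℕ) * Real.log 6 ≤ δ * (6 ^ m * γ ^ k) := by
    have h4 := mul_le_mul_of_nonneg_left hb (show 0 ≤ 6 ^ m * δ by positivity)
    have h5 := mul_le_mul_of_nonneg_left h2 (Nat.cast_nonneg (α := ℝ) k)
    push_cast
    nlinarith
  have h6 : Real.exp (-(δ * (6 ^ m * γ ^ k))) ≤ (1 / 6 : ℝ) ^ (k + 2) := by
    calc _ ≤ Real.exp (-((k + 2 : ℕ) * Real.log 6)) := Real.exp_le_exp.2 (by linarith)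
      _ = _ := by
        rw [Real.exp_neg, Real.exp_nat_mul, Real.exp_log (by norm_num), one_div, inv_pow]
  calc _ ≤ 3 ^ (k + 2) * (1 / 6 : ℝ) ^ (k + 2) := by gcongr
    _ = _ := by rw [← mul_pow]; norm_num

theorem coverEvent_of_forall_abundant {m : ℕ} {j : ℤ} {M γ : ℝ} (hM : 0 < M) (hγ : 0 < γ)
    {c : List mengerDigits × mengerDigits → Bool} (hc : ∀ k, c ∈ abundant m j M γ k) :
    c ∈ coverEvent := by
  refine ⟨m, j, fun k i hi hik => ?_⟩
  have h1 := hc k (3 ^ k * j + i) (Finset.mem_Ico.2 ⟨by omega, by omega⟩)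
  have h2 : 0 < addressCount (retainedFinset c (m + k)) (3 ^ k * j + i) := by
    exact_mod_cast lt_of_lt_of_le (show 0 < M * γ ^ k by positivity) h1
  obtain ⟨w, hw⟩ := Finset.card_pos.1 h2
  obtain ⟨hw, hwa⟩ := Finset.mem_filter.1 hw
  exact ⟨w, mem_retainedFinset.1 hw, hwa.le, by omega⟩

theorem IsCoinTossing.prob_coverEvent_pos (h : IsCoinTossing P p coin) (hp : 1 / 6 < p) :
    0 < P {ω | (fun e => coin e ω) ∈ coverEvent} := by
  have := h.indep.isProbabilityMeasure
  obtain ⟨τ, γ, hτ, hγ, hδ⟩ := exists_growth_parameters hp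
  obtain ⟨m, hm⟩ := exists_scale hδ hγ
  -- The full tree of depth `m + 1` provides the initial count `M = 6 ^ m` at the cell `2 * 3 ^ m`.
  set A : ℕ → Set Ω := fun k =>
    {ω | (fun e => coin e ω) ∈ abundantUpTo (m + 1) (2 * 3 ^ m) (6 ^ m) γ k} with hA
  have hAm : ∀ k, MeasurableSet (A k) := fun k =>
    h.measurable_pi (measurableSet_abundantUpTo ..)
  have hA0 : 0 < P.real (A 0) := by
    refine ENNReal.toReal_pos (ne_of_gt ?_) (measure_ne_top _ _)
    refine (h.prob_forall_head_pos (by linarith) (m + 1)).trans_le (measure_mono fun ω hω => ?_)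
    simp only [hA, abundantUpTo, Set.mem_ofPred_eq, Set.mem_iInter, Nat.le_zero]
    rintro i rfl t ht
    rw [pow_zero, one_mul] at ht
    obtain ⟨h1, h2⟩ := Finset.mem_Ico.1 ht
    simpa using six_pow_le_addressCount (c := fun e => coin e ω) hω h1 (by omega)
  have hAanti : Antitone A := fun k l hkl ω hω =>
    Set.mem_iInter₂.2 fun i hi => Set.mem_iInter₂.1 hω i (hi.trans hkl)
  have hstep : ∀ k, P.real (A k) - (1 / 2) ^ (k + 2) * P.real (A 0) ≤ P.real (A (k + 1)) := by
    intro k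
    have hdiff := h.prob_abundantUpTo_diff_le (by linarith) (γ := γ) (M := 6 ^ m) hτ (m + 1)
      (2 * 3 ^ m) k
    have hsub : A k \ A (k + 1) ⊆
        {ω | (fun e => coin e ω) ∈ abundantUpTo (m + 1) (2 * 3 ^ m) (6 ^ m) γ k ∧
          (fun e => coin e ω) ∉ abundant (m + 1) (2 * 3 ^ m) (6 ^ m) γ (k + 1)} := by
      rintro ω ⟨h1, h2⟩
      refine ⟨h1, fun h3 => h2 (Set.mem_iInter₂.2 fun i hi => ?_)⟩
      rcases Nat.le_succ_iff.1 hi with hi | rfl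
      · exact Set.mem_iInter₂.1 h1 i hi
      · exact h3
    have h1 : P.real (A k \ A (k + 1)) ≤ (1 / 2) ^ (k + 2) * P.real (A k) := by
      have h2 := ENNReal.toReal_mono (by finiteness) ((measure_mono hsub).trans hdiff)
      rw [ENNReal.toReal_mul, ENNReal.toReal_ofReal (by positivity)] at h2
      exact h2.trans (mul_le_mul_of_nonneg_right (hm k) measureReal_nonneg)
    rw [measureReal_sdiff (hAanti (Nat.le_succ k)) (hAm _)] at h1
    have h2 : P.real (A k) ≤ P.real (A 0) := measureReal_mono (hAanti (Nat.zero_le k))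
    have h3 := mul_le_mul_of_nonneg_left h2 (show (0 : ℝ) ≤ (1 / 2) ^ (k + 2) by positivity)
    linarith
  -- The losses `(1 / 2) ^ (k + 2)`, relative to `A 0`, sum to `1 / 2`, so half of the initial
  -- probability survives in the limit.
  have hlow : ∀ k, P.real (A 0) * (1 / 2 + (1 / 2) ^ (k + 1)) ≤ P.real (A k) := by
    intro k
    induction k with
    | zero => norm_num
    | succ k ih =>
      refine le_trans ?_ (hstep k)
      rw [pow_succ _ (k + 1)]
      linarith
  have hinter : ENNReal.ofReal (P.real (A 0) / 2) ≤ P (⋂ k, A k) := by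
    refine ge_of_tendsto (tendsto_measure_iInter_atTop (fun k => (hAm k).nullMeasurableSet) hAanti
      ⟨0, measure_ne_top _ _⟩) (Filter.Eventually.of_forall fun k => ?_)
    rw [Function.comp_apply, ENNReal.ofReal_le_iff_le_toReal (measure_ne_top _ _)]
    refine le_trans ?_ (hlow k)
    have : (0 : ℝ) ≤ (1 / 2) ^ (k + 1) := by positivity
    nlinarith
  refine (ENNReal.ofReal_pos.2 (by linarith)).trans_le (hinter.trans (measure_mono fun ω hω => ?_))
  exact coverEvent_of_forall_abundant (by positivity) (by linarith) fun k =>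
    Set.mem_iInter₂.1 (Set.mem_iInter.1 hω k) k le_rfl

theorem IsCoinTossing.ae_cond_containsInterval (h : IsCoinTossing P p coin) (hp : 1 / 6 < p)
    (hp1 : p ≤ 1) :
    0 < P {ω | NonExtinct fun e => coin e ω} ∧
      ∀ᵐ ω ∂(cond P {ω | NonExtinct fun e => coin e ω}),
        ContainsInterval (proj 1 1 1 '' mengerSponge fun e => coin e ω) := by
  have hpos := h.prob_coverEvent_pos hp
  have hset : {ω | NonExtinct fun e => coin e ω} = {ω | Survives fun e => coin e ω} := by
    ext ω
    exact nonExtinct_iff_survives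
  have hms : MeasurableSet {ω | Survives fun e => coin e ω} :=
    h.measurable_pi measurableSet_survives
  rw [hset]
  refine ⟨hpos.trans_le (measure_mono fun ω hω => survives_of_mem_coverEvent hω), ?_⟩
  have hnull := h.prob_survives_diff_eq_zero (by simp [card_mengerDigits]) hp1
    measurableSet_coverEvent (fun c hc => survives_of_mem_coverEvent hc)
    (fun c k hc => mem_coverEvent_of_mem_childEvent hc) hpos.ne'
  refine Measure.ae_smul_measure ((ae_restrict_iff' hms).2 ?_) _
  rw [ae_iff]
  refine measure_mono_null (fun ω hω => ?_) hnull
  obtain ⟨h1, h2⟩ := Classical.not_imp.1 hω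
  exact ⟨h1, fun hc => h2 (containsInterval_of_mem_coverEvent hc)⟩

end Growth

end RandomMenger

theorem theoremy55 {Ω : Type*} [MeasurableSpace Ω] (P : MeasureTheory.Measure Ω)
    [MeasureTheory.IsProbabilityMeasure P] (p : ℝ) (hp0 : 0 ≤ p) (hp1 : p ≤ 1)
    (coin : List RandomMenger.mengerDigits × RandomMenger.mengerDigits → Ω → Bool)
    (hcoin : RandomMenger.IsCoinTossing P p coin) :
    (1 / 6 < p →
      0 < P {ω | RandomMenger.NonExtinct fun e => coin e ω} ∧
      ∀ᵐ ω ∂(ProbabilityTheory.cond P {ω | RandomMenger.NonExtinct fun e => coin e ω}),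
        RandomMenger.ContainsInterval
          (RandomMenger.proj 1 1 1 '' RandomMenger.mengerSponge fun e => coin e ω)) ∧
    (p < 1 / 6 →
      ∀ᵐ ω ∂P, ¬ RandomMenger.ContainsInterval
        (RandomMenger.proj 1 1 1 '' RandomMenger.mengerSponge fun e => coin e ω)) :=
  ⟨fun hp => hcoin.ae_cond_containsInterval hp hp1, fun hp => hcoin.ae_not_containsInterval hp0 hp⟩
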